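/- Let $k$ be a field, let $Q$ be a finite quiver, and let $\Lambda = kQ/I$ be a quadratic monomial algebra, that is, $I$ is the two-sided ideal of the path algebra $kQ$ generated by a set of paths of length two. Grade $\Lambda$ by path length, and let $\Lambda_0 = \Lambda/\Lambda_{\ge 1}$ be the left $\Lambda$-module that is the direct sum of the simple modules at the vertices of $Q$. Let $M$ be a finitely presented $\mathbb{Z}$-graded left $\Lambda$-module. Then $\operatorname{Ext}^n_\Lambda(M,\Lambda_0)$ is a finite-dimensional $k$-vector space for every $n \ge 0$, and the Poincaré series $$P^\Lambda_M(t) = \sum_{n\ge 0} \dim_k \operatorname{Ext}^n_\Lambda(M,\Lambda_0)\, t^n$$ is rational: there are polynomials $p, q \in \mathbb{Q}[t]$ with $q(0) \ne 0$ and $q(t)\,P^\Lambda_M(t) = p(t)$ in $\mathbb{Q}[[t]]$. -/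

import Mathlib

open CategoryTheory

universe u v w

/-- A path of a quiver, together with its source and its target. -/
structure TotalPath (V : Type u) [Quiver.{v} V] : Type (max u v) where
  /-- the source of the path -/
  src : V
  /-- the target of the path -/
  tgt : V
  /-- the path itself -/
  path : Quiver.Path src tgt

/-- The length (number of arrows) of a path. -/
def TotalPath.length {V : Type u} [Quiver.{v} V] (p : TotalPath V) : ℕ := p.path.length

/-- The trivial path at a vertex. -/
def TotalPath.triv {V : Type u} [Quiver.{v} V] (a : V) : TotalPath V := ⟨a, a, Quiver.Path.nil⟩

/-- The path algebra `kQ`: the `k`-vector space with basis the paths of the quiver. -/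
def PathAlgebra (k : Type w) [Field k] (V : Type u) [Quiver.{v} V] : Type (max u v w) :=
  TotalPath V →₀ k

namespace PathAlgebra

noncomputable section

variable {k : Type w} [Field k] {V : Type u} [Quiver.{v} V]

instance : AddCommGroup (PathAlgebra k V) := inferInstanceAs (AddCommGroup (TotalPath V →₀ k))

instance : Module k (PathAlgebra k V) := inferInstanceAs (Module k (TotalPath V →₀ k))

/-- The basis vector of the path algebra given by a path. -/
def ofPath (k : Type w) [Field k] (p : TotalPath V) : PathAlgebra k V := Finsupp.single p (1 : k)

/-- The linear map out of the path algebra with prescribed values on the basis of paths. -/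
def lift {N : Type*} [AddCommGroup N] [Module k N] (f : TotalPath V → N) :
    PathAlgebra k V →ₗ[k] N :=
  Finsupp.linearCombination k f

theorem lift_ofPath {N : Type*} [AddCommGroup N] [Module k N] (f : TotalPath V → N)
    (p : TotalPath V) : lift f (ofPath k p) = f p :=
  (Finsupp.linearCombination_single k (1 : k) p).trans (one_smul k _)

theorem hom_ext {N : Type*} [AddCommGroup N] [Module k N] {f g : PathAlgebra k V →ₗ[k] N}
    (h : ∀ p, f (ofPath k p) = g (ofPath k p)) : f = g :=
  Finsupp.lhom_ext' fun p => LinearMap.ext_ring (h p)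

/-- The unit of the path algebra is the sum of the trivial paths. -/
instance [Fintype V] : One (PathAlgebra k V) := ⟨∑ a : V, ofPath k (TotalPath.triv a)⟩

theorem one_def [Fintype V] : (1 : PathAlgebra k V) = ∑ a : V, ofPath k (TotalPath.triv a) := rfl

variable [DecidableEq V]

/-- The product `p * q` of two paths in the path algebra: first `q`, then `p`, if `q` ends where `p`
starts, and zero otherwise. With this convention left modules are covariant representations of the
quiver. -/
def mulPath (k : Type w) [Field k] (p q : TotalPath V) : PathAlgebra k V :=
  if h : q.tgt = p.src then ofPath k ⟨q.src, p.tgt, (q.path.cast rfl h).comp p.path⟩ else 0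

/-- The multiplication of the path algebra, as a bilinear map. -/
def mulHom : PathAlgebra k V →ₗ[k] PathAlgebra k V →ₗ[k] PathAlgebra k V :=
  lift fun p => lift fun q => mulPath k p q

instance : Mul (PathAlgebra k V) := ⟨fun x y => mulHom x y⟩

theorem mul_def (x y : PathAlgebra k V) : x * y = mulHom x y := rfl

theorem ofPath_mul_ofPath (p q : TotalPath V) :
    ofPath k p * ofPath k q = mulPath k p q := by
  simp [mul_def, mulHom, lift_ofPath]

theorem mulPath_comp {a b c : V} (p : Quiver.Path b c) (q : Quiver.Path a b) :
    mulPath k ⟨b, c, p⟩ ⟨a, b, q⟩ = ofPath k ⟨a, c, q.comp p⟩ := by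
  simp [mulPath]

theorem mulPath_of_ne {p q : TotalPath V} (h : q.tgt ≠ p.src) : mulPath k p q = 0 := by
  simp [mulPath, h]

theorem mulHom_assoc_ofPath (p q r : TotalPath V) :
    mulHom (mulHom (ofPath k p) (ofPath k q)) (ofPath k r) =
      mulHom (ofPath k p) (mulHom (ofPath k q) (ofPath k r)) := by
  have key : ∀ p q : TotalPath V, mulHom (ofPath k p) (ofPath k q) = mulPath k p q :=
    ofPath_mul_ofPath
  obtain ⟨b, c, p⟩ := p
  obtain ⟨a, b', q⟩ := q
  obtain ⟨d, a', r⟩ := r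
  rw [key, key]
  by_cases h₁ : b' = b
  · subst h₁
    rw [mulPath_comp, key]
    by_cases h₂ : a' = a
    · subst h₂
      rw [mulPath_comp, mulPath_comp, key, mulPath_comp, Quiver.Path.comp_assoc]
    · rw [mulPath_of_ne (by exact h₂), mulPath_of_ne (by exact h₂), map_zero]
  · rw [mulPath_of_ne (by exact h₁), map_zero, LinearMap.zero_apply]
    by_cases h₂ : a' = a
    · subst h₂
      rw [mulPath_comp, key, mulPath_of_ne (by exact h₁)]
    · rw [mulPath_of_ne (by exact h₂), map_zero]

theorem mulHom_assoc (x y z : PathAlgebra k V) :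
    mulHom (mulHom x y) z = mulHom x (mulHom y z) := by
  have h₁ : ∀ p q : TotalPath V, ∀ z, mulHom (mulHom (ofPath k p) (ofPath k q)) z =
      mulHom (ofPath k p) (mulHom (ofPath k q) z) := fun p q z =>
    LinearMap.congr_fun (hom_ext (f := mulHom (mulHom (ofPath k p) (ofPath k q)))
      (g := (mulHom (ofPath k p)).comp (mulHom (ofPath k q)))
      fun r => mulHom_assoc_ofPath p q r) z
  have h₂ : ∀ p : TotalPath V, ∀ y z, mulHom (mulHom (ofPath k p) y) z =
      mulHom (ofPath k p) (mulHom y z) := fun p y z =>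
    LinearMap.congr_fun (hom_ext (f := (mulHom.flip z).comp (mulHom (ofPath k p)))
      (g := (mulHom (ofPath k p)).comp (mulHom.flip z)) fun q => h₁ p q z) y
  exact LinearMap.congr_fun (hom_ext (f := (mulHom.flip z).comp (mulHom.flip y))
    (g := mulHom.flip (mulHom y z)) fun p => h₂ p y z) x

variable [Fintype V]

theorem mulHom_one_left (x : PathAlgebra k V) : mulHom 1 x = x := by
  refine LinearMap.congr_fun (hom_ext (f := mulHom 1) (g := LinearMap.id) ?_) x
  rintro ⟨a, b, p⟩
  rw [one_def, map_sum, LinearMap.sum_apply, Finset.sum_eq_single b]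
  · exact (ofPath_mul_ofPath _ _).trans (mulPath_comp Quiver.Path.nil p)
  · intro c _ hc
    exact (ofPath_mul_ofPath _ _).trans (mulPath_of_ne (by exact hc.symm))
  · simp

theorem mulHom_one_right (x : PathAlgebra k V) : mulHom x 1 = x := by
  refine LinearMap.congr_fun (hom_ext (f := mulHom.flip 1) (g := LinearMap.id) ?_) x
  rintro ⟨a, b, p⟩
  rw [LinearMap.flip_apply, one_def, map_sum, Finset.sum_eq_single a]
  · refine (ofPath_mul_ofPath _ _).trans ((mulPath_comp p Quiver.Path.nil).trans ?_)
    rw [Quiver.Path.nil_comp, LinearMap.id_apply]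
  · intro c _ hc
    exact (ofPath_mul_ofPath _ _).trans (mulPath_of_ne (by exact hc))
  · simp

instance : Ring (PathAlgebra k V) :=
  { (inferInstance : AddCommGroup (PathAlgebra k V)) with
    left_distrib := fun x y z => map_add (mulHom x) y z
    right_distrib := fun x y z => LinearMap.map_add₂ mulHom x y z
    zero_mul := fun x => LinearMap.map_zero₂ mulHom x
    mul_zero := fun x => map_zero (mulHom x)
    mul_assoc := mulHom_assoc
    one_mul := mulHom_one_left
    mul_one := mulHom_one_right }

instance : Algebra k (PathAlgebra k V) :=
  Algebra.ofModule (fun r x y => LinearMap.map_smul₂ mulHom r x y)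
    (fun r x y => map_smul (mulHom x) r y)

end

end PathAlgebra

noncomputable section

variable (k : Type w) [Field k] {V : Type u} [Quiver.{v} V] [DecidableEq V] [Fintype V]

/-- The two-sided ideal of the path algebra generated by a set `R` of paths. -/
def monomialIdeal (R : Set (TotalPath V)) : TwoSidedIdeal (PathAlgebra k V) :=
  TwoSidedIdeal.span (PathAlgebra.ofPath k '' R)

/-- The monomial algebra `kQ/I`, where `I` is the two-sided ideal generated by the set `R` of paths.
It is a quadratic monomial algebra if all the paths in `R` have length two. -/
abbrev MonomialAlgebra (R : Set (TotalPath V)) : Type (max u v w) :=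
  (monomialIdeal k R).ringCon.Quotient

namespace MonomialAlgebra

variable (R : Set (TotalPath V))

/-- The class of a path in the monomial algebra. -/
def ofPath (p : TotalPath V) : MonomialAlgebra k R :=
  (PathAlgebra.ofPath k p : PathAlgebra k V)

/-- The grading of the monomial algebra by path length, indexed by the integers (so that it vanishes
in negative degrees). -/
def grading (i : ℤ) : Submodule k (MonomialAlgebra k R) :=
  Submodule.span k {x | ∃ p : TotalPath V, (p.length : ℤ) = i ∧ ofPath k R p = x}

/-- The left ideal of the elements of positive degree, generated by the paths of positive length. -/
def augmentationIdeal : Submodule (MonomialAlgebra k R) (MonomialAlgebra k R) :=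
  Submodule.span (MonomialAlgebra k R) {x | ∃ p : TotalPath V, 0 < p.length ∧ ofPath k R p = x}

/-- The left module `Λ₀ = Λ / Λ_{≥ 1}`, the direct sum of the simple modules at the vertices. -/
abbrev DegreeZero : Type (max u v w) :=
  MonomialAlgebra k R ⧸ augmentationIdeal k R

/-- The vector space `Ext^n_Λ(M, Λ₀)`, computed in the category of all left `Λ`-modules. -/
abbrev ExtDegreeZero (M : Type (max u v w)) [AddCommGroup M] [Module (MonomialAlgebra k R) M]
    (n : ℕ) : Type (max u v w) :=
  Abelian.Ext (ModuleCat.of (MonomialAlgebra k R) M)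
    (ModuleCat.of (MonomialAlgebra k R) (DegreeZero k R)) n

/-- The Poincaré series `∑ dim_k Ext^n_Λ(M, Λ₀) t^n` of a left module. -/
def poincareSeries (M : Type (max u v w)) [AddCommGroup M] [Module (MonomialAlgebra k R) M] :
    PowerSeries ℚ :=
  PowerSeries.mk fun n => (Module.finrank k (ExtDegreeZero k R M n) : ℚ)

end MonomialAlgebra

end

/-- A power series is rational if it is the expansion at zero of a quotient of two polynomials. -/
def PowerSeries.IsRational (f : PowerSeries ℚ) : Prop :=
  ∃ p q : Polynomial ℚ, q.coeff 0 ≠ 0 ∧ (q : PowerSeries ℚ) * f = (p : PowerSeries ℚ)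

/-! Write Λ for the algebra and D for the `k`-dual, which turns right ideals into left modules. For
an arrow `a` with source vertex idempotent `e`, the elements killed by left multiplication by `a`
form the right ideal (1 - e)Λ ⊕ ⊕ bΛ, where `b` runs over the arrows ending at the source of `a`
with ab = 0. This holds because the surviving paths are a basis and the relations are quadratic: a
nonzero path is killed by `a` on the left exactly when its last arrow is, or when the endpoints do
not match. Dualizing gives an exact sequence 0 → D(aΛ) → D(eΛ) → ∏ D(bΛ) → 0 with injective middle
term, so Ext^{n+2}(M, D(aΛ)) ≅ ∏ Ext^{n+1}(M, D(bΛ)) (`extDualOfArrowEquiv`).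

Likewise Λ₀ is the module of forms vanishing on every bΛ, so Ext^{n+2}(M, Λ₀) is the product of
Ext^{n+1}(M, D(bΛ)) over all arrows (`extDegreeZeroEquiv`). The dimensions of the Ext^{n+1}(M,
D(bΛ)) thus evolve under a fixed 0-1 matrix, and their generating series is rational by inverting 1
- tN (`isRational_mk_of_matrix_recursion`).

The recursion starts at Ext^1(M, D(aΛ)), whose finiteness is the remaining point, since D(aΛ) may be
infinite-dimensional. With 0 → K → F → M → 0 a finite free presentation, a map K → D(aΛ) extends to
F as soon as its associated linear form vanishes on a certain finite-dimensional subspace of K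
(`exists_finite_detecting`). -/

theorem LinearMap.exists_comp_eq_of_ker_le {K E F G : Type*} [Field K] [AddCommGroup E]
    [Module K E] [AddCommGroup F] [Module K F] [AddCommGroup G] [Module K G] {f : E →ₗ[K] F}
    {g : E →ₗ[K] G} (h : LinearMap.ker f ≤ LinearMap.ker g) : ∃ l : F →ₗ[K] G, l ∘ₗ f = g := by
  obtain ⟨r, hr⟩ := LinearMap.exists_leftInverse_of_injective
    ((LinearMap.ker f).liftQ f le_rfl) (Submodule.ker_liftQ_eq_bot _ _ _ le_rfl)
  refine ⟨(LinearMap.ker f).liftQ g h ∘ₗ r, LinearMap.ext fun x => ?_⟩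
  have := LinearMap.congr_fun hr ((LinearMap.ker f).mkQ x)
  simp only [LinearMap.comp_apply, Submodule.mkQ_apply, Submodule.liftQ_apply,
    LinearMap.id_apply] at this ⊢
  rw [this, Submodule.liftQ_apply]

/-! ### Linear recursions and rational power series. -/

section Rationality

open Polynomial

theorem isRational_mk_of_matrix_recursion {ι : Type*} [Fintype ι] [DecidableEq ι]
    (N : Matrix ι ι ℚ) (d : ℕ → ι → ℚ) (hd : ∀ n, d (n + 1) = N.mulVec (d n)) (f : ℕ → ℚ)
    (hf : ∀ n, f (n + 2) = ∑ i, d n i) :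
    (PowerSeries.mk f).IsRational := by
  let G : ι → PowerSeries ℚ := fun i => PowerSeries.mk fun n => d n i
  -- The recursion says that the vector `G` of generating series satisfies (1 - XN) G = `d 0`.
  -- Multiplying by the adjugate of `B` makes det(1 - XN), which is `N.charpolyRev`, a common
  -- denominator.
  let B : Matrix ι ι ℚ[X] := 1 - (X : ℚ[X]) • N.map C
  let φ : ℚ[X] →+* PowerSeries ℚ := Polynomial.coeToPowerSeries.ringHom
  have hG : (B.map φ).mulVec G = fun i => φ (C (d 0 i)) := by
    have hB : B.map φ = 1 - (PowerSeries.X : PowerSeries ℚ) • N.map (PowerSeries.C) := by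
      ext i j : 1
      by_cases h : i = j <;> simp [B, φ, h, mul_comm PowerSeries.X (PowerSeries.C _)]
    rw [hB, Matrix.sub_mulVec, Matrix.one_mulVec, Matrix.smul_mulVec]
    funext i
    ext n
    cases n with
    | zero => simp [G, φ]
    | succ n =>
      simp [G, φ, Matrix.mulVec, dotProduct, PowerSeries.coeff_succ_X_mul, hd]
  have hdet : ∀ i, (φ N.charpolyRev) * G i =
      φ ((B.adjugate.mulVec fun i => C (d 0 i)) i) := by
    intro i
    have h1 : (B.adjugate.map φ).mulVec ((B.map φ).mulVec G) = (φ N.charpolyRev) • G := by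
      rw [Matrix.mulVec_mulVec, ← RingHom.mapMatrix_apply, ← RingHom.mapMatrix_apply,
        ← map_mul, Matrix.adjugate_mul]
      have h : φ.mapMatrix (B.det • (1 : Matrix ι ι ℚ[X])) = φ B.det • 1 := by
        ext i j : 1
        by_cases h : i = j <;> simp [h]
      rw [h, Matrix.smul_mulVec, Matrix.one_mulVec]
      rfl
    have h2 := congrFun h1 i
    rw [hG] at h2
    simp only [Pi.smul_apply, smul_eq_mul] at h2
    rw [← h2, RingHom.map_mulVec]
    rfl
  -- The coefficients `f 0` and `f 1` are not governed by the recursion and enter the numerator as a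
  -- polynomial correction.
  refine ⟨N.charpolyRev * (C (f 0) + C (f 1) * X) + X ^ 2 *
    ∑ i, (B.adjugate.mulVec fun i => C (d 0 i)) i, N.charpolyRev, ?_, ?_⟩
  · rw [Polynomial.coeff_zero_eq_eval_zero, Matrix.eval_charpolyRev]
    exact one_ne_zero
  · have hP : PowerSeries.mk f = φ (C (f 0) + C (f 1) * X) + φ (X ^ 2) * ∑ i, G i := by
      ext n
      match n with
      | 0 => simp [φ]
      | 1 => simp [φ, PowerSeries.coeff_X_pow_mul']
      | n + 2 =>
        simp [φ, PowerSeries.coeff_X_pow_mul', hf, G]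
    have hφ : ∀ p : ℚ[X], (p : PowerSeries ℚ) = φ p := fun p => rfl
    rw [hφ, hφ, hP]
    simp only [map_add φ, map_mul φ, map_sum φ, ← hdet, ← Finset.mul_sum]
    ring

end Rationality

/-! ### Dimension shifting, finiteness of Ext^1, and finite products. -/

namespace CategoryTheory.Abelian.Ext

section

variable (k : Type*) [Field k] {C : Type*} [Category C] [Abelian C] [Linear k C] [HasExt.{w} C]

/-- Dimension shifting along a short exact sequence whose middle term is injective. -/
noncomputable def linearEquivOfInjective {S : ShortComplex C} (hS : S.ShortExact)
    [Injective S.X₂] (X : C) (n : ℕ) : Ext X S.X₃ (n + 1) ≃ₗ[k] Ext X S.X₁ (n + 2) :=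
  LinearEquiv.ofBijective (hS.extClass.postcompOfLinear k X rfl) <| by
    constructor
    · rw [injective_iff_map_eq_zero]
      intro x hx
      obtain ⟨y, hy⟩ := covariant_sequence_exact₃ X hS x rfl hx
      rw [← hy, eq_zero_of_injective y, zero_comp]
    · intro y
      obtain ⟨x, hx⟩ := covariant_sequence_exact₁ X hS y (eq_zero_of_injective _) rfl
      exact ⟨x, hx⟩

/-- An isomorphism in the second variable induces a linear equivalence of `Ext`. -/
noncomputable def linearEquivOfIso {Y Z : C} (i : Y ≅ Z) (X : C) (n : ℕ) :
    Ext X Y n ≃ₗ[k] Ext X Z n :=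
  LinearEquiv.ofLinearMap ((mk₀ i.hom).postcompOfLinear k X (add_zero n))
    ((mk₀ i.inv).postcompOfLinear k X (add_zero n))
    (by ext x; simp) (by ext x; simp)

/-- Ext^1 of the quotient is the cokernel of restriction from the projective term. If `Φ` detects
which maps extend, the connecting map factors through `Φ`, and Ext^1 becomes a quotient of `W`. -/
theorem finite_one_of_projective {S : ShortComplex C} (hS : S.ShortExact) [Projective S.X₂]
    (Y : C) {W : Type*} [AddCommGroup W] [Module k W] [Module.Finite k W]
    (Φ : (S.X₁ ⟶ Y) →ₗ[k] W) (hΦ : ∀ f, Φ f = 0 → ∃ g : S.X₂ ⟶ Y, S.f ≫ g = f) :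
    Module.Finite k (Ext S.X₃ Y 1) := by
  let δ : (S.X₁ ⟶ Y) →ₗ[k] Ext S.X₃ Y 1 :=
    (hS.extClass.precompOfLinear k Y (rfl : 1 + 0 = 1)) ∘ₗ (linearEquiv₀ (R := k)).symm.toLinearMap
  have hδ : Function.Surjective δ := by
    intro y
    obtain ⟨x, hx⟩ := contravariant_sequence_exact₃ hS Y y (eq_zero_of_projective _)
      (add_zero 1)
    exact ⟨linearEquiv₀ (R := k) x, by simpa [δ] using hx⟩
  have hker : LinearMap.ker Φ ≤ LinearMap.ker δ := by
    intro f hf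
    obtain ⟨g, rfl⟩ := hΦ f hf
    simp [δ, ← mk₀_comp_mk₀]
  obtain ⟨ψ, hψ⟩ : ∃ ψ : W →ₗ[k] Ext S.X₃ Y 1, ψ ∘ₗ Φ = δ :=
    LinearMap.exists_comp_eq_of_ker_le hker
  refine Module.Finite.of_surjective ψ fun y => ?_
  obtain ⟨x, rfl⟩ := hδ y
  exact ⟨Φ x, LinearMap.congr_fun hψ x⟩

end

section

variable (k : Type*) [Field k] {A : Type u} [Ring A] [Algebra k A] [HasExt.{w} (ModuleCat.{v} A)]

/-- `Ext` commutes with finite products of modules in the second variable. -/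
noncomputable def piLinearEquiv {ι : Type} [Fintype ι] [DecidableEq ι]
    (X : ModuleCat.{v} A) (Y : ι → Type v) [∀ i, AddCommGroup (Y i)] [∀ i, Module A (Y i)] (n : ℕ) :
    Ext X (ModuleCat.of A (∀ i, Y i)) n ≃ₗ[k] ∀ i, Ext X (ModuleCat.of A (Y i)) n :=
  LinearEquiv.ofLinearMap
    (LinearMap.pi fun i =>
      (mk₀ (ModuleCat.ofHom (LinearMap.proj i : (∀ i, Y i) →ₗ[A] Y i))).postcompOfLinear k X
        (add_zero n))
    (LinearMap.lsum k _ k fun i =>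
      (mk₀ (ModuleCat.ofHom (LinearMap.single A Y i))).postcompOfLinear k X (add_zero n))
    (by
      refine LinearMap.ext fun x => funext fun i => ?_
      simp only [LinearMap.comp_apply, LinearMap.pi_apply, LinearMap.lsum_apply,
        LinearMap.sum_apply, LinearMap.flip_apply, bilinearCompOfLinear_apply_apply, sum_comp,
        comp_assoc_of_second_deg_zero, mk₀_comp_mk₀, LinearMap.proj_apply, LinearMap.id_apply,
        ← ModuleCat.ofHom_comp]
      rw [Finset.sum_eq_single i _ (by simp), LinearMap.proj_comp_single_same,
        ModuleCat.ofHom_id, comp_mk₀_id]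
      intro j _ hj
      rw [LinearMap.proj_comp_single_ne A Y i j hj.symm]
      simp)
    (by
      refine LinearMap.ext fun x => ?_
      simp only [LinearMap.comp_apply, LinearMap.pi_apply, LinearMap.lsum_apply,
        LinearMap.sum_apply, LinearMap.flip_apply, bilinearCompOfLinear_apply_apply,
        comp_assoc_of_second_deg_zero, mk₀_comp_mk₀, LinearMap.proj_apply, LinearMap.id_apply,
        ← ModuleCat.ofHom_comp, ← comp_sum, ← mk₀_sum]
      convert comp_mk₀_id x using 2
      congr 1
      ext y i : 3
      simp [Finset.sum_apply, ModuleCat.hom_sum, Finset.univ_sum_single])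

end

end CategoryTheory.Abelian.Ext

/-! ### Duals of right ideals: injectivity and exact sequences. -/

/-- The `k`-dual of a `k`-algebra, as a left module over the algebra. -/
def CoregularModule (k : Type*) [Field k] (A : Type*) [Ring A] [Algebra k A] : Type _ := A →ₗ[k] k

namespace CoregularModule

section

variable {k : Type*} [Field k] {A : Type*} [Ring A] [Algebra k A]

instance : AddCommGroup (CoregularModule k A) := inferInstanceAs (AddCommGroup (A →ₗ[k] k))

instance : FunLike (CoregularModule k A) A k := inferInstanceAs (FunLike (A →ₗ[k] k) A k)

instance : LinearMapClass (CoregularModule k A) k A k :=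
  inferInstanceAs (LinearMapClass (A →ₗ[k] k) k A k)

/-- A linear form on the algebra, as an element of the coregular module. -/
def of (f : A →ₗ[k] k) : CoregularModule k A := f

/-- An element of the coregular module, as a linear form. -/
def form (f : CoregularModule k A) : A →ₗ[k] k := f

@[simp] theorem form_apply (f : CoregularModule k A) (x : A) : f.form x = f x := rfl

@[simp] theorem of_apply (f : A →ₗ[k] k) (x : A) : of f x = f x := rfl

@[ext] theorem ext {f g : CoregularModule k A} (h : ∀ x, f x = g x) : f = g := DFunLike.ext _ _ h

@[simp] theorem add_apply (f g : CoregularModule k A) (x : A) : (f + g) x = f x + g x := rfl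

@[simp] theorem zero_apply (x : A) : (0 : CoregularModule k A) x = 0 := rfl

instance : SMul A (CoregularModule k A) :=
  ⟨fun a f => of (f.form ∘ₗ LinearMap.mulRight k a)⟩

@[simp] theorem smul_apply (a : A) (f : CoregularModule k A) (x : A) : (a • f) x = f (x * a) := rfl

instance : Module A (CoregularModule k A) where
  one_smul f := by ext; simp
  mul_smul a b f := by ext; simp [mul_assoc]
  smul_zero a := by ext; simp
  smul_add a f g := by ext; simp
  add_smul a b f := by ext; simp [mul_add]
  zero_smul f := by ext; simp

variable (k) in
/-- The linear forms that vanish on the right ideal generated by a set. -/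
def coann (S : Set A) : Submodule A (CoregularModule k A) where
  carrier := {f | ∀ s ∈ S, ∀ x, f (s * x) = 0}
  add_mem' hf hg s hs x := by simp [hf s hs x, hg s hs x]
  zero_mem' s hs x := rfl
  smul_mem' a f hf s hs x := by simp [mul_assoc, hf s hs]

variable (k) in
/-- The dual of the right ideal generated by an element. -/
abbrev dualOf (a : A) : Submodule A (CoregularModule k A) := coann k {x | a * x = 0}

/-- Precomposition with left multiplication by an element of the algebra. -/
def mulLeft (a : A) : CoregularModule k A →ₗ[A] CoregularModule k A where
  toFun f := of (f.form ∘ₗ LinearMap.mulLeft k a)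
  map_add' f g := rfl
  map_smul' b f := by ext x; change f (a * x * b) = f (a * (x * b)); rw [mul_assoc]

@[simp] theorem mulLeft_apply (a : A) (f : CoregularModule k A) (x : A) :
    mulLeft a f x = f (a * x) := rfl

theorem mulLeft_mem_dualOf (a : A) (f : CoregularModule k A) : mulLeft a f ∈ dualOf k a := by
  intro s hs x
  rw [Set.mem_ofPred_eq] at hs
  rw [mulLeft_apply, ← mul_assoc, hs, zero_mul, map_zero]

/-- A form vanishing on the kernel of x ↦ ax factors through that map, so `dualOf k a` is the dual
of the right ideal aA. -/
theorem exists_mulLeft_eq {a : A} {f : CoregularModule k A} (hf : f ∈ dualOf k a) :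
    ∃ g, mulLeft a g = f := by
  obtain ⟨l, hl⟩ := LinearMap.exists_comp_eq_of_ker_le (f := LinearMap.mulLeft k a)
    (g := f.form) fun x hx =>
      (congrArg f (mul_one x)).symm.trans (hf x hx 1)
  exact ⟨of l, ext fun x => LinearMap.congr_fun hl x⟩

end

section

variable {k : Type w} [Field k] {A : Type u} [Ring A] [Algebra k A]

/-- `coann k {1 - e}` is D(eA), and A-linear maps X → D(eA) correspond to linear forms on eX. Linear
forms extend along injections. -/
theorem injective_coann {e : A} (he : e * e = e) :
    Module.Injective A (coann k {1 - e}) := by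
  constructor
  intro X Y _ _ _ _ f hf g
  let : Module k X := Module.restrictScalars k A X
  let : Module k Y := Module.restrictScalars k A Y
  have : IsScalarTower k A X := IsScalarTower.restrictScalars k A X
  have : IsScalarTower k A Y := IsScalarTower.restrictScalars k A Y
  obtain ⟨l, hl⟩ := LinearMap.exists_leftInverse_of_injective (f.restrictScalars k)
    (LinearMap.ker_eq_bot.2 hf)
  have hl' : ∀ x, l (f x) = x := LinearMap.congr_fun hl
  have hg : ∀ x a, (g x).1 (e * a) = (g x).1 a := by
    intro x a
    have := (g x).2 (1 - e) rfl a
    rw [sub_mul, one_mul, map_sub, sub_eq_zero] at this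
    exact this.symm
  let g₁ : X →ₗ[k] k :=
    { toFun := fun x => (g x).1 1
      map_add' := fun x y => by simp
      map_smul' := fun c x => by
        rw [← algebraMap_smul A c x, map_smul]
        simp [Algebra.algebraMap_eq_smul_one] }
  -- The extension sends y to the form a ↦ `g₁ (l (e a y))`. The factor `e` makes this form vanish
  -- on (1 - e)A.
  let h : Y →ₗ[A] coann k {1 - e} :=
    { toFun := fun y => ⟨of (g₁ ∘ₗ l ∘ₗ (LinearMap.toSpanSingleton A Y y).restrictScalars k ∘ₗ
          LinearMap.mulLeft k e), by
        rintro s rfl x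
        simp only [of_apply, LinearMap.comp_apply, LinearMap.mulLeft_apply]
        rw [← mul_assoc, mul_sub, he, mul_one, sub_self, zero_mul, map_zero, map_zero, map_zero]⟩
      map_add' := fun y z => by
        ext x
        simp
      map_smul' := fun a y => by
        ext x
        simp [mul_smul] }
  refine ⟨h, fun x => Subtype.ext (ext fun a => ?_)⟩
  change g₁ (l ((e * a) • f x)) = _
  rw [← map_smul f, hl']
  change (g ((e * a) • x)).1 1 = _
  rw [map_smul]
  change (g x).1 (1 * (e * a)) = _
  rw [one_mul, hg]

variable {ι : Type}

/-- Restriction of linear forms to the right ideals generated by a family of elements. -/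
def restrict (e : A) (b : ι → A) : coann k {1 - e} →ₗ[A] ∀ i, dualOf k (b i) :=
  LinearMap.pi fun i => LinearMap.codRestrict _ (mulLeft (b i) ∘ₗ Submodule.subtype _)
    fun _ => mulLeft_mem_dualOf _ _

theorem restrict_apply_apply (e : A) (b : ι → A) (f : coann k {1 - e}) (i : ι) (x : A) :
    (restrict e b f i).1 x = f.1 (b i * x) := rfl

theorem restrict_surjective [Fintype ι] {e : A} (he : e * e = e) {b : ι → A}
    (heb : ∀ i, e * b i = b i)
    (π : ι → A →ₗ[k] A) (hπ : ∀ i x, π i (b i * x) = b i * x)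
    (hπ' : ∀ i j x, i ≠ j → π i (b j * x) = 0) :
    Function.Surjective (restrict (k := k) e b) := by
  intro h
  choose g hg using fun i => exists_mulLeft_eq (h i).2
  -- The prescribed forms on the ideals bᵢA are glued by the projections `π i`, which make the sum
  -- of these ideals direct.
  refine ⟨⟨of ((∑ i, (g i).form ∘ₗ π i) ∘ₗ LinearMap.mulLeft k e), ?_⟩, ?_⟩
  · rintro s rfl x
    simp only [of_apply, LinearMap.comp_apply, LinearMap.mulLeft_apply]
    rw [← mul_assoc, mul_sub, he, mul_one, sub_self, zero_mul, map_zero]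
  · refine funext fun j => Subtype.ext (ext fun x => ?_)
    rw [restrict_apply_apply]
    simp only [of_apply, LinearMap.comp_apply, LinearMap.mulLeft_apply, LinearMap.sum_apply]
    rw [← mul_assoc, heb, Finset.sum_eq_single j _ (by simp), hπ, ← hg]
    · rfl
    · intro i _ hi
      rw [hπ' i j x hi, map_zero]

/-- The inclusion of the linear forms that vanish on a family of elements into those that vanish on
the complement of an idempotent. -/
def inclusion (e : A) (b : ι → A) :
    coann k ({1 - e} ∪ Set.range b) →ₗ[A] coann k {1 - e} :=
  Submodule.inclusion fun _ hf s hs => hf s (Or.inl hs)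

theorem inclusion_injective (e : A) (b : ι → A) :
    Function.Injective (inclusion (k := k) e b) :=
  Submodule.inclusion_injective _

theorem exact_inclusion_restrict (e : A) (b : ι → A) :
    Function.Exact (inclusion (k := k) e b) (restrict e b) := by
  intro f
  constructor
  · intro hf
    refine ⟨⟨f.1, ?_⟩, rfl⟩
    rintro s (hs | ⟨i, rfl⟩) x
    · exact f.2 s hs x
    · rw [← restrict_apply_apply e b, hf]
      rfl
  · rintro ⟨f, rfl⟩
    refine funext fun i => Subtype.ext (ext fun x => ?_)
    exact f.2 (b i) (Or.inr ⟨i, rfl⟩) x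

/-- Dimension shifting for the linear forms that vanish on a direct sum of principal right
ideals. -/
noncomputable def extSuccEquiv [Fintype ι] {e : A} (he : e * e = e) {b : ι → A}
    (heb : ∀ i, e * b i = b i)
    (π : ι → A →ₗ[k] A) (hπ : ∀ i x, π i (b i * x) = b i * x)
    (hπ' : ∀ i j x, i ≠ j → π i (b j * x) = 0) (X : ModuleCat.{max u w} A) (n : ℕ) :
    Abelian.Ext X (ModuleCat.of A (coann k ({1 - e} ∪ Set.range b))) (n + 2) ≃ₗ[k]
      ∀ i, Abelian.Ext X (ModuleCat.of A (dualOf k (b i))) (n + 1) := by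
  let S : ShortComplex (ModuleCat.{max u w} A) :=
    ShortComplex.mk (ModuleCat.ofHom (inclusion (k := k) e b)) (ModuleCat.ofHom (restrict e b))
      (by rw [← ModuleCat.ofHom_comp, (exact_inclusion_restrict e b).linearMap_comp_eq_zero]; rfl)
  have hS : S.ShortExact :=
    { exact := (ShortComplex.ShortExact.moduleCat_exact_iff_function_exact S).2
        (exact_inclusion_restrict e b)
      mono_f := (ModuleCat.mono_iff_injective _).2 (inclusion_injective e b)
      epi_g := (ModuleCat.epi_iff_surjective _).2 (restrict_surjective he heb π hπ hπ') }
  classical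
  have : Module.Injective A (coann k {1 - e}) := injective_coann he
  have : Injective S.X₂ := Module.injective_object_of_injective_module A _
  exact (Abelian.Ext.linearEquivOfInjective k hS X n).symm.trans
    (Abelian.Ext.piLinearEquiv k X _ (n + 1))

end

end CoregularModule

/-! ### Finiteness of Ext^1 with values in D(aA). -/

namespace CoregularModule

section

variable {k : Type*} [Field k] {A : Type*} [Ring A] [Algebra k A]

/-- A linear map from a submodule `K` of a free module to `dualOf k a` extends to the free module
if the associated linear form vanishes on the elements of `K` that are killed by `a`. -/
theorem exists_extension {ι : Type*} (K : Submodule A (ι → A)) (a : A) (h : K →ₗ[A] dualOf k a)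
    (hh : ∀ y : K, a • y = 0 → (h y).1 1 = 0) :
    ∃ h' : (ι → A) →ₗ[A] dualOf k a, h' ∘ₗ K.subtype = h := by
  let g : K →ₗ[k] k :=
    { toFun := fun y => (h y).1 1
      map_add' := fun x y => by simp
      map_smul' := fun c x => by
        rw [← algebraMap_smul A c x, map_smul]
        simp [Algebra.algebraMap_eq_smul_one] }
  have hg : ∀ x y, g (x • y) = (h y).1 x := fun x y => by
    change (h (x • y)).1 1 = _
    rw [map_smul]
    change (h y).1 (1 * x) = _
    rw [one_mul]
  -- The form y ↦ h(y)(1) determines h. When it factors through y ↦ ay as `G`, the map f ↦ (x ↦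
  -- G(axf)) is defined on the whole free module.
  let L : K →ₗ[k] (ι → A) := Algebra.lsmul k k (ι → A) a ∘ₗ K.subtype.restrictScalars k
  obtain ⟨G, hG⟩ := LinearMap.exists_comp_eq_of_ker_le (f := L) (g := g) fun y hy =>
    hh y (Subtype.ext hy)
  have hG' : ∀ y : K, G (a • (y : ι → A)) = g y := LinearMap.congr_fun hG
  refine ⟨
    { toFun := fun f => ⟨of (G ∘ₗ (LinearMap.toSpanSingleton A (ι → A) f).restrictScalars k ∘ₗ
        LinearMap.mulLeft k a), ?_⟩
      map_add' := fun f g => by ext x; simp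
      map_smul' := fun b f => by ext x; simp [mul_smul] }, ?_⟩
  · intro s hs x
    rw [Set.mem_ofPred_eq] at hs
    simp only [of_apply, LinearMap.comp_apply, LinearMap.mulLeft_apply]
    rw [← mul_assoc, hs, zero_mul, map_zero, map_zero]
  · ext y x
    change G ((a * x) • (y : ι → A)) = (h y).1 x
    rw [mul_smul, ← hg]
    exact hG' (x • y)

/-- If the kernel of left multiplication by `a` is controlled by a projection `T` that is
compatible with a decomposition of `A` into a finite-dimensional space and finitely many principal
right ideals, then a finite-dimensional space detects which maps to `dualOf k a` from a
finitely generated submodule of a free module extend. -/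
theorem exists_finite_detecting {ι κ : Type*} [Finite ι] [Fintype κ] (a : A) (T : A →ₗ[k] A)
    (hT : ∀ x, a * x = 0 → T x = x) (E : Submodule k A) [Module.Finite k E] (b : κ → A)
    (hb : ∀ x, ∃ y ∈ E, ∃ c : κ → A, x = y + ∑ i, b i * c i)
    (hTb : ∀ i, (∀ x, T (b i * x) = 0) ∨ (a * b i = 0 ∧ ∀ x, T (b i * x) = b i * x))
    (K : Submodule A (ι → A)) (hK : K.FG) :
    ∃ W : Submodule k K, Module.Finite k W ∧ ∀ h : K →ₗ[A] dualOf k a,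
      (∀ y ∈ W, (h y).1 1 = 0) → ∃ h' : (ι → A) →ₗ[A] dualOf k a, h' ∘ₗ K.subtype = h := by
  obtain ⟨m, g, rfl⟩ := Submodule.fg_iff_exists_fin_generating_family.1 hK
  let Ψ : (Fin m → E) →ₗ[k] (ι → A) := ∑ j,
    (LinearMap.toSpanSingleton A (ι → A) (g j)).restrictScalars k ∘ₗ E.subtype ∘ₗ LinearMap.proj j
  let T' : (ι → A) →ₗ[k] (ι → A) := LinearMap.pi fun i => T ∘ₗ LinearMap.proj i
  -- The test space is the intersection of K with T'(Ψ(E^m)), which is finite-dimensional because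
  -- both `E` and the number of generators of K are finite.
  let W : Submodule k (Submodule.span A (Set.range g)) :=
    (LinearMap.range (T' ∘ₗ Ψ)).comap
      ((Submodule.span A (Set.range g)).subtype.restrictScalars k)
  -- Decomposing the coefficients of the generators keeps each `c i` inside K, so `h` can later be
  -- applied to `c i`.
  have hdec : ∀ y ∈ Submodule.span A (Set.range g), ∃ (ε : Fin m → E)
      (c : κ → Submodule.span A (Set.range g)), y = Ψ ε + ∑ i, b i • (c i : ι → A) := by
    intro y hy
    obtain ⟨l, rfl⟩ := (Submodule.mem_span_range_iff_exists_fun A).1 hy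
    choose ε hε c hc using fun j => hb (l j)
    refine ⟨fun j => ⟨ε j, hε j⟩, fun i => ∑ j, c j i • ⟨g j, Submodule.subset_span ⟨j, rfl⟩⟩, ?_⟩
    have : ∀ j, l j • g j = ε j • g j + ∑ i, b i • c j i • g j := fun j => by
      rw [hc j, add_smul, Finset.sum_smul]
      simp only [mul_smul]
    simp only [this, Finset.sum_add_distrib]
    congr 1
    · simp [Ψ]
    · rw [Finset.sum_comm]
      simp [Finset.smul_sum]
  have hT' : ∀ y : ι → A, a • y = 0 → T' y = y := fun y hy =>
    funext fun i => hT _ (congrFun hy i)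
  refine ⟨W, ?_, fun h hW => exists_extension _ a h fun y hy => ?_⟩
  · have : Module.Finite k (LinearMap.range (T' ∘ₗ Ψ)) := inferInstance
    exact Module.Finite.of_injective
      (((Submodule.span A (Set.range g)).subtype.restrictScalars k).restrict
        (p := W) (q := LinearMap.range (T' ∘ₗ Ψ)) fun x hx => hx)
      fun x y hxy => by
        have h := congrArg (fun z => z.1) hxy
        exact Subtype.ext (Subtype.ext h)
  · obtain ⟨ε, c, hc⟩ := hdec y.1 y.2
    classical
    let κ' := Finset.univ.filter fun i => a * b i = 0 ∧ ∀ x, T (b i * x) = b i * x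
    have hsum : T' (∑ i, b i • (c i : ι → A)) = ∑ i ∈ κ', b i • (c i : ι → A) := by
      rw [map_sum, Finset.sum_filter]
      refine Finset.sum_congr rfl fun i _ => ?_
      split_ifs with hi
      · exact funext fun j => hi.2 _
      · exact funext fun j => ((hTb i).resolve_right hi) _
    -- Since ay = 0, the projection fixes y. It erases every term with abᵢ ≠ 0 and keeps the others.
    have hy' : y.1 = T' (Ψ ε) + ∑ i ∈ κ', b i • (c i : ι → A) := by
      rw [← hsum, ← map_add, ← hc, hT' _ (congrArg Subtype.val hy)]
    have hmem : y - ∑ i ∈ κ', b i • c i ∈ W := by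
      refine ⟨ε, ?_⟩
      simp [hy']
    have h1 := hW _ hmem
    -- Here h(bᵢcᵢ)(1) = h(cᵢ)(bᵢ), and forms in D(aA) vanish on bᵢ because abᵢ = 0. Only the part
    -- of y in W can obstruct.
    have h2 : ∀ i ∈ κ', (h (b i • c i)).1 1 = 0 := by
      intro i hi
      rw [map_smul]
      change (h (c i)).1 (1 * b i) = 0
      rw [one_mul, ← mul_one (b i)]
      exact (h (c i)).2 (b i) (Finset.mem_filter.1 hi).2.1 1
    have h3 : h y = h (y - ∑ i ∈ κ', b i • c i) + ∑ i ∈ κ', h (b i • c i) := by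
      rw [← map_sum, ← map_add, sub_add_cancel]
    let ev : dualOf k a →+ k := ⟨⟨fun f => f.1 1, rfl⟩, fun f g => rfl⟩
    change ev (h y) = 0
    rw [h3, map_add, map_sum]
    exact (congrArg₂ (· + ·) h1 (Finset.sum_eq_zero h2)).trans (add_zero 0)

end

section

variable {k : Type w} [Field k] {A : Type u} [Ring A] [Algebra k A]

/-- Maps from a finitely generated module to a module that embeds into a finite-dimensional
vector space form a finite-dimensional vector space. -/
theorem finite_hom (M Y : ModuleCat.{v} A) [Module.Finite A M] {W : Type*} [AddCommGroup W] [Module k W] [Module.Finite k W]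
    (l : Y →+ W) (hl : Function.Injective l) (hl' : ∀ (r : k) y, l (algebraMap k A r • y) = r • l y) :
    Module.Finite k (M ⟶ Y) := by
  obtain ⟨n, g, hg⟩ := Module.Finite.exists_fin (R := A) (M := M)
  let Φ : (M ⟶ Y) →ₗ[k] (Fin n → W) :=
    { toFun := fun f i => l (f.hom (g i))
      map_add' := fun f f' => funext fun i => l.map_add _ _
      map_smul' := fun r f => funext fun i => hl' r (f.hom (g i)) }
  refine Module.Finite.of_injective Φ fun f f' hff' => ModuleCat.hom_ext ?_
  exact LinearMap.ext_on_range hg fun i => hl (congrFun hff' i)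

theorem finite_ext_zero_of_finite (M Y : ModuleCat.{max u w} A) [Module.Finite A M]
    {W : Type*} [AddCommGroup W] [Module k W] [Module.Finite k W]
    (l : Y →+ W) (hl : Function.Injective l) (hl' : ∀ (r : k) y, l (algebraMap k A r • y) = r • l y) :
    Module.Finite k (Abelian.Ext M Y 0) :=
  have : Module.Finite k (M ⟶ Y) := finite_hom _ _ l hl hl'
  Module.Finite.equiv (Abelian.Ext.linearEquiv₀ (R := k)).symm

/-- A finite free presentation of a module, as a short exact sequence. -/
theorem exists_presentation (M : Type (max u w)) [AddCommGroup M] [Module A M]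
    [Module.FinitePresentation A M] : ∃ (n : ℕ) (K : Submodule A (ULift.{w} (Fin n) → A))
      (p : (ULift.{w} (Fin n) → A) →ₗ[A] M), K.FG ∧
        (ModuleCat.ofHom K.subtype ≫ ModuleCat.ofHom p = 0) ∧
        ∀ h : ModuleCat.ofHom K.subtype ≫ ModuleCat.ofHom p = 0,
          (ShortComplex.mk _ _ h).ShortExact := by
  obtain ⟨n, p, hp⟩ := Module.Finite.exists_fin' A M
  let q : (ULift.{w} (Fin n) → A) →ₗ[A] M :=
    p ∘ₗ (LinearEquiv.funCongrLeft A A (Equiv.ulift.{w} (α := Fin n)).symm).toLinearMap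
  have hq : Function.Surjective q := hp.comp (LinearEquiv.surjective _)
  refine ⟨n, LinearMap.ker q, q, Module.FinitePresentation.fg_ker q hq, ?_, fun h => ?_⟩
  · rw [← ModuleCat.ofHom_comp, LinearMap.comp_ker_subtype]
    rfl
  · exact
      { exact := (ShortComplex.ShortExact.moduleCat_exact_iff_function_exact _).2
          (LinearMap.exact_subtype_ker_map q)
        mono_f := (ModuleCat.mono_iff_injective _).2 (Submodule.injective_subtype _)
        epi_g := (ModuleCat.epi_iff_surjective _).2 hq }

theorem finite_ext_one_of_finite (M : Type (max u w)) [AddCommGroup M] [Module A M]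
    [Module.FinitePresentation A M] (Y : ModuleCat.{max u w} A)
    {W : Type*} [AddCommGroup W] [Module k W] [Module.Finite k W]
    (l : Y →+ W) (hl : Function.Injective l) (hl' : ∀ (r : k) y, l (algebraMap k A r • y) = r • l y) :
    Module.Finite k (Abelian.Ext (ModuleCat.of A M) Y 1) := by
  obtain ⟨n, K, p, hK, h, hS⟩ := exists_presentation.{u, w} (A := A) M
  have : Module.Finite A (ModuleCat.of A K) := Module.Finite.iff_fg.2 hK
  have : Module.Finite k (ModuleCat.of A K ⟶ Y) := finite_hom _ _ l hl hl'
  have : Projective (ModuleCat.of A (ULift.{w} (Fin n) → A)) :=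
    (IsProjective.iff_projective _).1 inferInstance
  exact Abelian.Ext.finite_one_of_projective k (hS h) Y LinearMap.id fun f hf =>
    ⟨0, by rw [Limits.comp_zero]; exact hf.symm⟩

/-- A map h from K is recorded by the restriction of y ↦ h(y)(1) to the finite-dimensional detecting
space, and maps with zero record extend. -/
theorem finite_ext_one_dualOf {κ : Type*} [Fintype κ] (a : A) (T : A →ₗ[k] A)
    (hT : ∀ x, a * x = 0 → T x = x) (E : Submodule k A) [Module.Finite k E] (b : κ → A)
    (hb : ∀ x, ∃ y ∈ E, ∃ c : κ → A, x = y + ∑ i, b i * c i)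
    (hTb : ∀ i, (∀ x, T (b i * x) = 0) ∨ (a * b i = 0 ∧ ∀ x, T (b i * x) = b i * x))
    (M : Type (max u w)) [AddCommGroup M] [Module A M] [Module.FinitePresentation A M] :
    Module.Finite k (Abelian.Ext (ModuleCat.of A M) (ModuleCat.of A (dualOf k a)) 1) := by
  obtain ⟨n, K, p, hK, h, hS⟩ := exists_presentation.{u, w} (A := A) M
  obtain ⟨W, hW, hW'⟩ := exists_finite_detecting a T hT E b hb hTb K hK
  have : Projective (ModuleCat.of A (ULift.{w} (Fin n) → A)) :=
    (IsProjective.iff_projective _).1 inferInstance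
  have hsmul : ∀ (r : k) (f : dualOf k a), (algebraMap k A r • f).1 1 = r • f.1 1 := fun r f => by
    change f.1 (1 * algebraMap k A r) = _
    rw [one_mul, Algebra.algebraMap_eq_smul_one, map_smul]
  let Φ : (ModuleCat.of A K ⟶ ModuleCat.of A (dualOf k a)) →ₗ[k] (W →ₗ[k] k) :=
    { toFun := fun f =>
        { toFun := fun y => (f.hom y.1).1 1
          map_add' := fun y z => by
            rw [Submodule.coe_add, map_add]
            rfl
          map_smul' := fun r y => by
            rw [Submodule.coe_smul, ← algebraMap_smul A r (y : K), map_smul]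
            exact hsmul r _ }
      map_add' := fun f g => rfl
      map_smul' := fun r f => LinearMap.ext fun y => hsmul r (f.hom y.1) }
  have : Module.Free k W := Module.Free.of_divisionRing k W
  refine Abelian.Ext.finite_one_of_projective k (hS h) _ Φ fun f hf => ?_
  obtain ⟨h', hh'⟩ := hW' f.hom fun y hy => LinearMap.congr_fun hf ⟨y, hy⟩
  exact ⟨ModuleCat.ofHom h', ModuleCat.hom_ext hh'⟩

end

end CoregularModule

/-! ### Paths containing a relation. -/

section Paths

variable {V : Type u} [Quiver.{v} V]

/-- A path contains a relation if one of its subpaths of length two belongs to `R`. -/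
inductive ContainsRelation (R : Set (TotalPath V)) : ∀ {a b : V}, Quiver.Path a b → Prop
  | rel {a b c d : V} (p : Quiver.Path a b) (e : b ⟶ c) (f : c ⟶ d)
      (h : (⟨b, d, (Quiver.Path.nil.cons e).cons f⟩ : TotalPath V) ∈ R) :
      ContainsRelation R ((p.cons e).cons f)
  | cons {a b c : V} (p : Quiver.Path a b) (e : b ⟶ c) (h : ContainsRelation R p) :
      ContainsRelation R (p.cons e)

namespace ContainsRelation

variable {R : Set (TotalPath V)}

theorem comp_right {a b c : V} {p : Quiver.Path a b} (h : ContainsRelation R p)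
    (q : Quiver.Path b c) : ContainsRelation R (p.comp q) := by
  induction q with
  | nil => exact h
  | cons q e ih => exact cons _ e ih

theorem comp_left {a b c : V} (p : Quiver.Path a b) {q : Quiver.Path b c}
    (h : ContainsRelation R q) : ContainsRelation R (p.comp q) := by
  induction h with
  | rel q e f h => exact rel (p.comp q) e f h
  | cons q e _ ih => exact cons _ e ih

theorem not_nil {a : V} : ¬ ContainsRelation R (Quiver.Path.nil : Quiver.Path a a) := nofun

theorem not_singleton {a b : V} (e : a ⟶ b) :
    ¬ ContainsRelation R (Quiver.Path.nil.cons e) := by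
  rintro (_ | ⟨_, _, h⟩)
  exact not_nil h

/-- Relations have length two, so appending an arrow can only create one at the end of the path. -/
theorem of_cons_cons {a b c d : V} {p : Quiver.Path a b} {e : b ⟶ c} {f : c ⟶ d}
    (h : ContainsRelation R ((p.cons e).cons f)) :
    ContainsRelation R (p.cons e) ∨
      (⟨b, d, (Quiver.Path.nil.cons e).cons f⟩ : TotalPath V) ∈ R := by
  cases h with
  | rel _ _ _ h => exact Or.inr h
  | cons _ _ h => exact Or.inl h

theorem of_mem {r : TotalPath V} (hr : r ∈ R) (h : r.length = 2) : ContainsRelation R r.path := by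
  obtain ⟨a, b, p⟩ := r
  change p.length = 2 at h
  match p, h with
  | .cons (.cons .nil e) f, _ => exact rel _ e f hr

end ContainsRelation

/-- The arrows of a quiver. -/
abbrev TotalArrow (V : Type u) [Quiver.{v} V] : Type (max u v) := Σ a b : V, (a ⟶ b)

/-- An arrow, as a path of length one. -/
def TotalArrow.path (b : TotalArrow V) : TotalPath V :=
  ⟨b.1, b.2.1, Quiver.Path.nil.cons b.2.2⟩

/-- The last arrow of a path. -/
def TotalPath.last : TotalPath V → Option (TotalArrow V)
  | ⟨_, _, .nil⟩ => none
  | ⟨_, _, .cons _ e⟩ => some ⟨_, _, e⟩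

end Paths

/-! ### The monomial ideal as a span of paths. -/

namespace PathAlgebra

variable {k : Type w} [Field k] {V : Type u} [Quiver.{v} V]

theorem span_range_ofPath : Submodule.span k (Set.range (ofPath k (V := V))) = ⊤ := by
  rw [eq_top_iff]
  intro x _
  have : x = Finsupp.linearCombination k (ofPath k) (x : TotalPath V →₀ k) := by
    refine LinearMap.congr_fun (hom_ext (f := LinearMap.id)
      (g := lift (k := k) (ofPath k (V := V))) fun p => ?_) x
    rw [lift_ofPath, LinearMap.id_apply]
  rw [this]
  exact Finsupp.mem_span_range_iff_exists_finsupp.2 ⟨x, rfl⟩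

variable (k) in
/-- The span of the paths that contain a relation. -/
noncomputable def relationSpan (R : Set (TotalPath V)) : Submodule k (PathAlgebra k V) :=
  Submodule.span k {x | ∃ p : TotalPath V, ContainsRelation R p.path ∧ ofPath k p = x}

variable [DecidableEq V] [Fintype V] {R : Set (TotalPath V)}

theorem mul_mem_relationSpan (x : PathAlgebra k V) {y : PathAlgebra k V}
    (hy : y ∈ relationSpan k R) : x * y ∈ relationSpan k R := by
  have hx : x ∈ Submodule.span k (Set.range (ofPath k (V := V))) :=
    span_range_ofPath (k := k) (V := V) ▸ Submodule.mem_top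
  induction hx, hy using Submodule.span_induction₂ with
  | mem_mem x y hx hy =>
    obtain ⟨⟨b, c, p⟩, rfl⟩ := hx
    obtain ⟨⟨a, b', q⟩, hq, rfl⟩ := hy
    rw [ofPath_mul_ofPath]
    by_cases h : b' = b
    · subst h
      rw [mulPath_comp]
      exact Submodule.subset_span ⟨_, hq.comp_right p, rfl⟩
    · rw [mulPath_of_ne (by exact h)]
      exact zero_mem _
  | zero_left y hy => rw [zero_mul]; exact zero_mem _
  | zero_right x hx => rw [mul_zero]; exact zero_mem _
  | add_left x y z _ _ _ h₁ h₂ => rw [add_mul]; exact add_mem h₁ h₂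
  | add_right x y z _ _ _ h₁ h₂ => rw [mul_add]; exact add_mem h₁ h₂
  | smul_left r x y _ _ h => rw [smul_mul_assoc]; exact Submodule.smul_mem _ _ h
  | smul_right r x y _ _ h => rw [mul_smul_comm]; exact Submodule.smul_mem _ _ h

theorem mem_mul_relationSpan {x : PathAlgebra k V} (hx : x ∈ relationSpan k R)
    (y : PathAlgebra k V) : x * y ∈ relationSpan k R := by
  have hy : y ∈ Submodule.span k (Set.range (ofPath k (V := V))) :=
    span_range_ofPath (k := k) (V := V) ▸ Submodule.mem_top
  induction hx, hy using Submodule.span_induction₂ with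
  | mem_mem x y hx hy =>
    obtain ⟨⟨a, b', q⟩, rfl⟩ := hy
    obtain ⟨⟨b, c, p⟩, hp, rfl⟩ := hx
    rw [ofPath_mul_ofPath]
    by_cases h : b' = b
    · subst h
      rw [mulPath_comp]
      exact Submodule.subset_span ⟨_, hp.comp_left q, rfl⟩
    · rw [mulPath_of_ne (by exact h)]
      exact zero_mem _
  | zero_left y hy => rw [zero_mul]; exact zero_mem _
  | zero_right x hx => rw [mul_zero]; exact zero_mem _
  | add_left x y z _ _ _ h₁ h₂ => rw [add_mul]; exact add_mem h₁ h₂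
  | add_right x y z _ _ _ h₁ h₂ => rw [mul_add]; exact add_mem h₁ h₂
  | smul_left r x y _ _ h => rw [smul_mul_assoc]; exact Submodule.smul_mem _ _ h
  | smul_right r x y _ _ h => rw [mul_smul_comm]; exact Submodule.smul_mem _ _ h

/-- The span of the paths containing a relation is already a two-sided ideal, so it contains the
ideal generated by `R`. -/
theorem mem_relationSpan_of_mem_monomialIdeal (hR : ∀ r ∈ R, r.length = 2) {x : PathAlgebra k V}
    (hx : x ∈ monomialIdeal k R) : x ∈ relationSpan k R := by
  let I : TwoSidedIdeal (PathAlgebra k V) := TwoSidedIdeal.mk' (relationSpan k R) (zero_mem _)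
    add_mem neg_mem (mul_mem_relationSpan _) (fun h => mem_mul_relationSpan h _)
  have h : ∀ y, y ∈ I ↔ y ∈ relationSpan k R := fun y => by simp [I]
  refine (h x).1 (TwoSidedIdeal.span_le.2 ?_ hx)
  rintro _ ⟨r, hr, rfl⟩
  exact (h _).2 (Submodule.subset_span ⟨r, .of_mem hr (hR r hr), rfl⟩)

theorem ofPath_mem_monomialIdeal {a b : V} {p : Quiver.Path a b} (h : ContainsRelation R p) :
    ofPath k ⟨a, b, p⟩ ∈ monomialIdeal k R := by
  induction h with
  | @rel b c d p e f h =>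
    have : ofPath k ⟨a, d, (p.cons e).cons f⟩ =
        ofPath k ⟨b, d, (Quiver.Path.nil.cons e).cons f⟩ * ofPath k ⟨a, b, p⟩ := by
      rw [ofPath_mul_ofPath, mulPath_comp]
      rfl
    rw [this]
    exact TwoSidedIdeal.mul_mem_right _ _ _ (TwoSidedIdeal.subset_span ⟨_, h, rfl⟩)
  | @cons b c p e h ih =>
    have : ofPath k ⟨a, c, p.cons e⟩ =
        ofPath k ⟨b, c, Quiver.Path.nil.cons e⟩ * ofPath k ⟨a, b, p⟩ := by
      rw [ofPath_mul_ofPath, mulPath_comp]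
      rfl
    rw [this]
    exact TwoSidedIdeal.mul_mem_left _ _ _ ih

end PathAlgebra

/-! ### The path basis of the monomial algebra and left multiplication by arrows. -/

noncomputable section

namespace MonomialAlgebra

variable {k : Type w} [Field k] {V : Type u} [Quiver.{v} V] [DecidableEq V] [Fintype V]
  {R : Set (TotalPath V)}

variable (k R) in
/-- The projection of the path algebra onto the monomial algebra. -/
def proj : PathAlgebra k V →ₗ[k] MonomialAlgebra k R where
  toFun x := (x : MonomialAlgebra k R)
  map_add' _ _ := rfl
  map_smul' _ _ := rfl

theorem proj_surjective : Function.Surjective (proj k R) := fun x =>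
  Quotient.inductionOn' x fun y => ⟨y, rfl⟩

theorem proj_eq_zero_iff {x : PathAlgebra k V} : proj k R x = 0 ↔ x ∈ monomialIdeal k R := by
  rw [TwoSidedIdeal.mem_iff]
  exact RingCon.eq _

theorem ofPath_eq_zero {a b : V} {p : Quiver.Path a b} (h : ContainsRelation R p) :
    ofPath k R ⟨a, b, p⟩ = 0 :=
  proj_eq_zero_iff.2 (PathAlgebra.ofPath_mem_monomialIdeal h)

theorem hom_ext {N : Type*} [AddCommGroup N] [Module k N] {f g : MonomialAlgebra k R →ₗ[k] N}
    (h : ∀ p, f (ofPath k R p) = g (ofPath k R p)) : f = g := by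
  refine LinearMap.ext fun x => ?_
  obtain ⟨x, rfl⟩ := proj_surjective x
  exact LinearMap.congr_fun (PathAlgebra.hom_ext (f := f ∘ₗ proj k R) (g := g ∘ₗ proj k R) h) x

theorem span_range_ofPath : Submodule.span k (Set.range (ofPath k R)) = ⊤ := by
  have := congrArg (Submodule.map (proj k R)) (PathAlgebra.span_range_ofPath (k := k) (V := V))
  rw [Submodule.map_span, ← Set.range_comp, Submodule.map_top,
    LinearMap.range_eq_top.2 proj_surjective] at this
  exact this

open Classical in
/-- The linear map out of a quadratic monomial algebra with prescribed values on the paths that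
contain no relation. -/
def lift (hR : ∀ r ∈ R, r.length = 2) {N : Type*} [AddCommGroup N] [Module k N]
    (f : TotalPath V → N) : MonomialAlgebra k R →ₗ[k] N :=
  (LinearMap.ker (proj k R)).liftQ
      (PathAlgebra.lift fun p => if ContainsRelation R p.path then 0 else f p) (by
        intro x hx
        have := PathAlgebra.mem_relationSpan_of_mem_monomialIdeal hR (proj_eq_zero_iff.1 hx)
        refine Submodule.span_le.2 ?_ this
        rintro _ ⟨p, hp, rfl⟩
        change PathAlgebra.lift _ _ = 0
        rw [PathAlgebra.lift_ofPath, if_pos hp]) ∘ₗ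
    ((proj k R).quotKerEquivOfSurjective proj_surjective).symm.toLinearMap

open Classical in
theorem lift_ofPath (hR : ∀ r ∈ R, r.length = 2) {N : Type*} [AddCommGroup N] [Module k N]
    (f : TotalPath V → N) (p : TotalPath V) :
    lift hR f (ofPath k R p) = if ContainsRelation R p.path then 0 else f p := by
  have : ((proj k R).quotKerEquivOfSurjective proj_surjective).symm (ofPath k R p) =
      (LinearMap.ker (proj k R)).mkQ (PathAlgebra.ofPath k p) := by
    rw [LinearEquiv.symm_apply_eq]
    rfl
  rw [lift, LinearMap.comp_apply, LinearEquiv.coe_coe, this, Submodule.mkQ_apply,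
    Submodule.liftQ_apply, PathAlgebra.lift_ofPath]

theorem lift_ofPath_of_zero (hR : ∀ r ∈ R, r.length = 2) {N : Type*} [AddCommGroup N] [Module k N]
    (f : TotalPath V → N) (hf : ∀ p, ContainsRelation R p.path → f p = 0) (p : TotalPath V) :
    lift hR f (ofPath k R p) = f p := by
  rw [lift_ofPath]
  split_ifs with h
  · exact (hf p h).symm
  · rfl

theorem ofPath_eq_zero_iff (hR : ∀ r ∈ R, r.length = 2) {a b : V} {p : Quiver.Path a b} :
    ofPath k R ⟨a, b, p⟩ = 0 ↔ ContainsRelation R p := by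
  refine ⟨fun h => ?_, ofPath_eq_zero⟩
  by_contra hp
  have := lift_ofPath (k := k) hR (fun _ => (1 : k)) ⟨a, b, p⟩
  rw [h, map_zero, if_neg hp] at this
  exact zero_ne_one this

theorem ofPath_mul_ofPath {a b c : V} (p : Quiver.Path b c) (q : Quiver.Path a b) :
    ofPath k R ⟨b, c, p⟩ * ofPath k R ⟨a, b, q⟩ = ofPath k R ⟨a, c, q.comp p⟩ :=
  congrArg (proj k R)
    ((PathAlgebra.ofPath_mul_ofPath (k := k) _ _).trans (PathAlgebra.mulPath_comp p q))

theorem ofPath_mul_ofPath_of_ne {p q : TotalPath V} (h : q.tgt ≠ p.src) :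
    ofPath k R p * ofPath k R q = 0 :=
  congrArg (proj k R)
    ((PathAlgebra.ofPath_mul_ofPath (k := k) _ _).trans (PathAlgebra.mulPath_of_ne h))

variable (k R) in
/-- The class of an arrow in the monomial algebra. -/
def arrow (b : TotalArrow V) : MonomialAlgebra k R := ofPath k R b.path

variable (k R) in
/-- The idempotent of a vertex. -/
def vertex (a : V) : MonomialAlgebra k R := ofPath k R (TotalPath.triv a)

theorem arrow_mul_ofPath {a b c : V} (e : b ⟶ c) (p : Quiver.Path a b) :
    arrow k R ⟨b, c, e⟩ * ofPath k R ⟨a, b, p⟩ = ofPath k R ⟨a, c, p.cons e⟩ :=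
  ofPath_mul_ofPath _ _

theorem vertex_mul_ofPath (p : TotalPath V) : vertex k R p.tgt * ofPath k R p = ofPath k R p :=
  ofPath_mul_ofPath _ _

theorem vertex_mul_ofPath_of_ne {a : V} {p : TotalPath V} (h : p.tgt ≠ a) :
    vertex k R a * ofPath k R p = 0 :=
  ofPath_mul_ofPath_of_ne h

theorem vertex_mul_vertex (a : V) : vertex k R a * vertex k R a = vertex k R a :=
  vertex_mul_ofPath (TotalPath.triv a)

theorem arrow_mul_vertex (b : TotalArrow V) : arrow k R b * vertex k R b.1 = arrow k R b :=
  ofPath_mul_ofPath _ _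

open Classical in
variable (k) in
/-- The projection onto the right ideal generated by an arrow. -/
def arrowProj (hR : ∀ r ∈ R, r.length = 2) (b : TotalArrow V) :
    MonomialAlgebra k R →ₗ[k] MonomialAlgebra k R :=
  lift hR fun p => if p.last = some b then ofPath k R p else 0

open Classical in
theorem arrowProj_ofPath (hR : ∀ r ∈ R, r.length = 2) (b : TotalArrow V) (p : TotalPath V) :
    arrowProj k hR b (ofPath k R p) = if p.last = some b then ofPath k R p else 0 :=
  lift_ofPath_of_zero hR _ (fun p hp => by rw [ofPath_eq_zero hp, ite_self]) p

theorem arrowProj_arrow_mul (hR : ∀ r ∈ R, r.length = 2) (b : TotalArrow V)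
    (x : MonomialAlgebra k R) : arrowProj k hR b (arrow k R b * x) = arrow k R b * x := by
  refine LinearMap.congr_fun (hom_ext (f := arrowProj k hR b ∘ₗ LinearMap.mulLeft k (arrow k R b))
    (g := LinearMap.mulLeft k (arrow k R b)) fun p => ?_) x
  simp only [LinearMap.comp_apply, LinearMap.mulLeft_apply]
  obtain ⟨a, c, p⟩ := p
  obtain ⟨s, t, e⟩ := b
  by_cases h : c = s
  · subst h
    rw [arrow_mul_ofPath, arrowProj_ofPath]
    exact if_pos rfl
  · rw [arrow, ofPath_mul_ofPath_of_ne (by exact h), map_zero]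

theorem arrowProj_arrow_mul_of_ne (hR : ∀ r ∈ R, r.length = 2) {b c : TotalArrow V} (hbc : b ≠ c)
    (x : MonomialAlgebra k R) : arrowProj k hR b (arrow k R c * x) = 0 := by
  refine LinearMap.congr_fun (hom_ext (f := arrowProj k hR b ∘ₗ LinearMap.mulLeft k (arrow k R c))
    (g := 0) fun p => ?_) x
  simp only [LinearMap.comp_apply, LinearMap.mulLeft_apply, LinearMap.zero_apply]
  obtain ⟨a, d, p⟩ := p
  obtain ⟨s, t, e⟩ := c
  by_cases h : d = s
  · subst h
    rw [arrow_mul_ofPath, arrowProj_ofPath, if_neg]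
    exact fun h => hbc (Option.some.inj h).symm
  · rw [arrow, ofPath_mul_ofPath_of_ne (by exact h), map_zero]

open Classical in
variable (k) in
/-- The projection onto the elements that are killed by left multiplication with an arrow. -/
def kernelProj (hR : ∀ r ∈ R, r.length = 2) (a : TotalArrow V) :
    MonomialAlgebra k R →ₗ[k] MonomialAlgebra k R :=
  lift hR fun p => if arrow k R a * ofPath k R p = 0 then ofPath k R p else 0

open Classical in
theorem kernelProj_ofPath (hR : ∀ r ∈ R, r.length = 2) (a : TotalArrow V) (p : TotalPath V) :
    kernelProj k hR a (ofPath k R p) =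
      if arrow k R a * ofPath k R p = 0 then ofPath k R p else 0 :=
  lift_ofPath_of_zero hR _ (fun p hp => by rw [ofPath_eq_zero hp, ite_self]) p

open Classical in
variable (k R) in
/-- The path obtained by deleting the last arrow, if this is a given arrow. -/
def cancelPath (a : TotalArrow V) : TotalPath V → MonomialAlgebra k R
  | ⟨_, _, .nil⟩ => 0
  | ⟨x, _, @Quiver.Path.cons _ _ _ b c p e⟩ =>
    if (⟨b, c, e⟩ : TotalArrow V) = a then ofPath k R ⟨x, b, p⟩ else 0

/-- Prepending `a` in the product appends it to the path, and `cancelPath` deletes it again. The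
composite is the identity on surviving paths not killed by `a` and zero on the others, hence equals
1 - `kernelProj`. -/
theorem kernelProj_of_mul_eq_zero (hR : ∀ r ∈ R, r.length = 2) (a : TotalArrow V)
    {x : MonomialAlgebra k R} (hx : arrow k R a * x = 0) : kernelProj k hR a x = x := by
  have : lift hR (cancelPath k R a) ∘ₗ LinearMap.mulLeft k (arrow k R a) =
      LinearMap.id - kernelProj k hR a := by
    refine hom_ext fun p => ?_
    simp only [LinearMap.comp_apply, LinearMap.mulLeft_apply, LinearMap.sub_apply,
      LinearMap.id_apply, kernelProj_ofPath]
    obtain ⟨c, d, p⟩ := p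
    obtain ⟨s, t, e⟩ := a
    split_ifs with h
    · rw [h, map_zero, sub_self]
    · by_cases hd : d = s
      · subst hd
        rw [arrow_mul_ofPath] at h ⊢
        rw [lift_ofPath, if_neg fun h' => h (ofPath_eq_zero h'), sub_zero]
        exact if_pos rfl
      · exact absurd (ofPath_mul_ofPath_of_ne (by exact hd)) h
  have h := LinearMap.congr_fun this x
  rw [LinearMap.comp_apply, LinearMap.mulLeft_apply, hx, map_zero, LinearMap.sub_apply] at h
  exact (sub_eq_zero.1 h.symm).symm

/-- This is where quadraticity acts: whether `a` kills a nonzero path of positive length depends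
only on the last arrow of that path. -/
theorem arrow_mul_ofPath_eq_zero (hR : ∀ r ∈ R, r.length = 2) {a : TotalArrow V} {x y z : V}
    {p : Quiver.Path x y} {e : y ⟶ z} (h : arrow k R a * ofPath k R ⟨x, z, p.cons e⟩ = 0) :
    ofPath k R ⟨x, z, p.cons e⟩ = 0 ∨ arrow k R a * arrow k R ⟨y, z, e⟩ = 0 := by
  obtain ⟨s, t, f⟩ := a
  by_cases hz : z = s
  · subst hz
    rw [arrow_mul_ofPath, ofPath_eq_zero_iff hR] at h
    refine h.of_cons_cons.imp ofPath_eq_zero fun h => ?_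
    rw [arrow.eq_1 k R ⟨y, z, e⟩, TotalArrow.path, arrow_mul_ofPath]
    exact ofPath_eq_zero (.rel _ _ _ h)
  · exact Or.inr (ofPath_mul_ofPath_of_ne (by exact hz))

theorem arrow_ne_zero (hR : ∀ r ∈ R, r.length = 2) (a : TotalArrow V) : arrow k R a ≠ 0 :=
  fun h => ContainsRelation.not_singleton _ ((ofPath_eq_zero_iff hR).1 h)

theorem kernelProj_arrow_mul (hR : ∀ r ∈ R, r.length = 2) {a b : TotalArrow V}
    (hab : arrow k R a * arrow k R b ≠ 0) (x : MonomialAlgebra k R) :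
    kernelProj k hR a (arrow k R b * x) = 0 := by
  refine LinearMap.congr_fun (hom_ext (f := kernelProj k hR a ∘ₗ LinearMap.mulLeft k (arrow k R b))
    (g := 0) fun p => ?_) x
  simp only [LinearMap.comp_apply, LinearMap.mulLeft_apply, LinearMap.zero_apply]
  obtain ⟨c, d, p⟩ := p
  obtain ⟨s, t, e⟩ := b
  by_cases h : d = s
  · subst h
    rw [arrow_mul_ofPath, kernelProj_ofPath]
    split_ifs with h'
    · exact (arrow_mul_ofPath_eq_zero hR h').resolve_right hab
    · rfl
  · rw [arrow.eq_1 k R ⟨s, t, e⟩, ofPath_mul_ofPath_of_ne (by exact h), map_zero]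

variable (k R) in
/-- The span of the idempotents of the vertices. -/
def vertexSpan : Submodule k (MonomialAlgebra k R) := Submodule.span k (Set.range (vertex k R))

instance : Module.Finite k (vertexSpan k R) :=
  Module.Finite.span_of_finite k (Set.finite_range _)

theorem exists_decomposition {κ : Type*} [Fintype κ] (b : κ ≃ TotalArrow V)
    (x : MonomialAlgebra k R) :
    ∃ y ∈ vertexSpan k R, ∃ c : κ → MonomialAlgebra k R, x = y + ∑ i, arrow k R (b i) * c i := by
  classical
  have hx : x ∈ Submodule.span k (Set.range (ofPath k R)) :=
    span_range_ofPath (k := k) (R := R) ▸ Submodule.mem_top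
  induction hx using Submodule.span_induction with
  | mem x hx =>
    obtain ⟨⟨s, t, p⟩, rfl⟩ := hx
    cases p with
    | nil => exact ⟨_, Submodule.subset_span ⟨s, rfl⟩, 0, by simp; rfl⟩
    | @cons m _ p e =>
      refine ⟨0, zero_mem _, Pi.single (b.symm ⟨m, t, e⟩) (ofPath k R ⟨s, m, p⟩), ?_⟩
      rw [zero_add, Finset.sum_eq_single (b.symm ⟨m, t, e⟩), Pi.single_eq_same,
        Equiv.apply_symm_apply, arrow_mul_ofPath]
      · intro i _ hi
        rw [Pi.single_eq_of_ne hi, mul_zero]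
      · simp
  | zero => exact ⟨0, zero_mem _, 0, by simp⟩
  | add x x' _ _ h h' =>
    obtain ⟨y, hy, c, rfl⟩ := h
    obtain ⟨y', hy', c', rfl⟩ := h'
    refine ⟨y + y', add_mem hy hy', c + c', ?_⟩
    simp only [Pi.add_apply, mul_add, Finset.sum_add_distrib]
    abel
  | smul r x _ h =>
    obtain ⟨y, hy, c, rfl⟩ := h
    exact ⟨r • y, Submodule.smul_mem _ _ hy, r • c, by simp [Finset.smul_sum]⟩

end MonomialAlgebra

end

/-! ### The Ext recursion for monomial algebras. -/

noncomputable section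

namespace MonomialAlgebra

open CoregularModule

variable {k : Type w} [Field k] {V : Type u} [Quiver.{v} V] [DecidableEq V] [Fintype V]
  {R : Set (TotalPath V)}

/-- The kernel of left multiplication by `a` is spanned by paths. A path in it not ending at the
source of `a` lies in (1 - e)Λ. One that does is nontrivial, as `a` is nonzero, and if it survives
in Λ it lies in bΛ for its last arrow b, with ab = 0. -/
theorem dualOf_arrow_eq_coann (hR : ∀ r ∈ R, r.length = 2) {κ : Type*} (b : κ ≃ TotalArrow V)
    (a : TotalArrow V) :
    dualOf k (arrow k R a) = coann k ({1 - vertex k R a.1} ∪ Set.range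
      fun j : {j // (b j).2.1 = a.1 ∧ arrow k R a * arrow k R (b j) = 0} => arrow k R (b j)) := by
  refine le_antisymm ?_ ?_
  · rintro f hf s (rfl | ⟨j, rfl⟩)
    · exact hf _ (by rw [Set.mem_ofPred_eq, mul_sub, mul_one, arrow_mul_vertex, sub_self])
    · exact hf _ j.2.2
  · intro f hf x hx y
    rw [Set.mem_ofPred_eq] at hx
    rw [← kernelProj_of_mul_eq_zero hR a hx]
    refine LinearMap.congr_fun (hom_ext (f := f.form ∘ₗ LinearMap.mulRight k y ∘ₗ
      kernelProj k hR a) (g := 0) fun p => ?_) x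
    simp only [LinearMap.comp_apply, LinearMap.mulRight_apply, LinearMap.zero_apply, form_apply,
      kernelProj_ofPath]
    split_ifs with hp
    · by_cases hpa : p.tgt = a.1
      · obtain ⟨c, d, p⟩ := p
        cases p with
        | nil =>
          change c = a.1 at hpa
          subst hpa
          exact absurd ((arrow_mul_vertex a).symm.trans hp) (arrow_ne_zero hR a)
        | @cons m _ p e =>
          rcases arrow_mul_ofPath_eq_zero hR hp with h | h
          · rw [h, zero_mul, map_zero]
          · rw [← arrow_mul_ofPath, mul_assoc]
            refine hf _ (Or.inr ⟨⟨b.symm ⟨m, d, e⟩, ?_⟩, ?_⟩) _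
            · rw [Equiv.apply_symm_apply]
              exact ⟨hpa, h⟩
            · simp only [Equiv.apply_symm_apply]
      · have h := hf _ (Or.inl rfl) (ofPath k R p * y)
        rwa [sub_mul, one_mul, ← mul_assoc, vertex_mul_ofPath_of_ne hpa, zero_mul, sub_zero] at h
    · rw [zero_mul, map_zero]

theorem vertex_mul_arrow (b : TotalArrow V) : vertex k R b.2.1 * arrow k R b = arrow k R b :=
  vertex_mul_ofPath b.path

/-- The recursion for the extensions by the duals of the right ideals generated by arrows. -/
def extDualOfArrowEquiv (hR : ∀ r ∈ R, r.length = 2) {κ : Type} [Fintype κ]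
    (b : κ ≃ TotalArrow V) (a : TotalArrow V)
    [Fintype {j // (b j).2.1 = a.1 ∧ arrow k R a * arrow k R (b j) = 0}]
    (X : ModuleCat.{max u v w} (MonomialAlgebra k R)) (n : ℕ) :
    Abelian.Ext X (ModuleCat.of (MonomialAlgebra k R) (dualOf k (arrow k R a))) (n + 2) ≃ₗ[k]
      ∀ j : {j // (b j).2.1 = a.1 ∧ arrow k R a * arrow k R (b j) = 0},
        Abelian.Ext X (ModuleCat.of (MonomialAlgebra k R) (dualOf k (arrow k R (b j)))) (n + 1) :=
  (Abelian.Ext.linearEquivOfIso k (LinearEquiv.toModuleIso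
    (LinearEquiv.ofEq _ _ (dualOf_arrow_eq_coann hR b a))) X (n + 2)).trans <|
  extSuccEquiv (e := vertex k R a.1)
    (b := fun j : {j // (b j).2.1 = a.1 ∧ arrow k R a * arrow k R (b j) = 0} => arrow k R (b j))
    (vertex_mul_vertex a.1)
    (fun j => (congrArg (vertex k R · * arrow k R (b j)) j.2.1.symm).trans (vertex_mul_arrow _)) (fun j => arrowProj k hR (b j))
    (fun j => arrowProj_arrow_mul hR (b j))
    (fun _ _ x hij => arrowProj_arrow_mul_of_ne hR
      (fun h => hij (Subtype.ext (b.injective h))) x) X n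

theorem finite_ext_one_dualOf_arrow [∀ a b : V, Finite (a ⟶ b)] (hR : ∀ r ∈ R, r.length = 2)
    (a : TotalArrow V) (M : Type (max u v w)) [AddCommGroup M] [Module (MonomialAlgebra k R) M]
    [Module.FinitePresentation (MonomialAlgebra k R) M] :
    Module.Finite k (Abelian.Ext (ModuleCat.of (MonomialAlgebra k R) M)
      (ModuleCat.of (MonomialAlgebra k R) (dualOf k (arrow k R a))) 1) := by
  have := Fintype.ofFinite (TotalArrow V)
  refine finite_ext_one_dualOf.{max u v w, w} (arrow k R a) (kernelProj k hR a)
    (fun x => kernelProj_of_mul_eq_zero hR a) (vertexSpan k R) (arrow k R)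
    (exists_decomposition (Equiv.refl _)) (fun i => ?_) M
  by_cases h : arrow k R a * arrow k R i = 0
  · refine Or.inr ⟨h, fun x => kernelProj_of_mul_eq_zero hR a ?_⟩
    rw [← mul_assoc, h, zero_mul]
  · exact Or.inl (kernelProj_arrow_mul hR h)

open Classical in
variable (k) in
/-- The sum of the coefficients at the trivial paths. -/
def augmentation (hR : ∀ r ∈ R, r.length = 2) : MonomialAlgebra k R →ₗ[k] k :=
  lift hR fun p => if p.length = 0 then 1 else 0

theorem augmentation_ofPath_of_pos (hR : ∀ r ∈ R, r.length = 2) {p : TotalPath V}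
    (hp : 0 < p.length) : augmentation k hR (ofPath k R p) = 0 := by
  rw [augmentation, lift_ofPath, if_neg hp.ne', ite_self]

theorem augmentation_vertex (hR : ∀ r ∈ R, r.length = 2) (a : V) :
    augmentation k hR (vertex k R a) = 1 := by
  rw [augmentation, vertex, lift_ofPath]
  exact (if_neg ContainsRelation.not_nil).trans (if_pos rfl)

theorem augmentation_mul_of_pos (hR : ∀ r ∈ R, r.length = 2) {p : TotalPath V}
    (hp : 0 < p.length) (x : MonomialAlgebra k R) :
    augmentation k hR (x * ofPath k R p) = 0 := by
  refine LinearMap.congr_fun (hom_ext (f := augmentation k hR ∘ₗ LinearMap.mulRight k (ofPath k R p))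
    (g := 0) fun q => ?_) x
  simp only [LinearMap.comp_apply, LinearMap.mulRight_apply, LinearMap.zero_apply]
  obtain ⟨b, c, q⟩ := q
  obtain ⟨a, b', p⟩ := p
  by_cases h : b' = b
  · subst h
    rw [ofPath_mul_ofPath]
    refine augmentation_ofPath_of_pos hR ?_
    change 0 < (p.comp q).length
    rw [Quiver.Path.length_comp]
    exact Nat.add_pos_left hp _
  · rw [ofPath_mul_ofPath_of_ne (by exact h), map_zero]

theorem augmentation_arrow_mul (hR : ∀ r ∈ R, r.length = 2) (b : TotalArrow V)
    (x : MonomialAlgebra k R) : augmentation k hR (arrow k R b * x) = 0 := by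
  refine LinearMap.congr_fun (hom_ext (f := augmentation k hR ∘ₗ LinearMap.mulLeft k (arrow k R b))
    (g := 0) fun q => ?_) x
  simp only [LinearMap.comp_apply, LinearMap.mulLeft_apply, LinearMap.zero_apply]
  obtain ⟨a, c, q⟩ := q
  obtain ⟨s, t, e⟩ := b
  by_cases h : c = s
  · subst h
    rw [arrow_mul_ofPath]
    exact augmentation_ofPath_of_pos hR (Nat.succ_pos _)
  · rw [arrow, ofPath_mul_ofPath_of_ne (by exact h), map_zero]

theorem vertex_mul_vertex_of_ne {a b : V} (h : a ≠ b) : vertex k R a * vertex k R b = 0 :=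
  ofPath_mul_ofPath_of_ne (by exact h.symm)

/-- The augmentation of `vertex k R a * x` reads off the coefficient of `x` at the trivial path at
`a`. Subtracting these terms leaves paths of positive length. -/
theorem sub_sum_mem_augmentationIdeal (hR : ∀ r ∈ R, r.length = 2) (x : MonomialAlgebra k R) :
    x - ∑ a, augmentation k hR (vertex k R a * x) • vertex k R a ∈ augmentationIdeal k R := by
  let f : MonomialAlgebra k R →ₗ[k] MonomialAlgebra k R := LinearMap.id - ∑ a,
    ((augmentation k hR) ∘ₗ LinearMap.mulLeft k (vertex k R a)).smulRight (vertex k R a)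
  have hf : (⊤ : Submodule k (MonomialAlgebra k R)) ≤
      ((augmentationIdeal k R).restrictScalars k).comap f := by
    rw [← span_range_ofPath, Submodule.span_le]
    rintro _ ⟨p, rfl⟩
    change f _ ∈ augmentationIdeal k R
    simp only [f, LinearMap.sub_apply, LinearMap.id_apply, LinearMap.sum_apply,
      LinearMap.smulRight_apply, LinearMap.comp_apply, LinearMap.mulLeft_apply]
    obtain ⟨a, b, p⟩ := p
    cases p with
    | nil =>
      change vertex k R a - ∑ c, augmentation k hR (vertex k R c * vertex k R a) • _ ∈ _
      rw [Finset.sum_eq_single a, vertex_mul_vertex, augmentation_vertex, one_smul, sub_self]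
      · exact zero_mem _
      · intro c _ hc
        rw [vertex_mul_vertex_of_ne hc, map_zero, zero_smul]
      · simp
    | cons p e =>
      have hp : 0 < (⟨a, b, p.cons e⟩ : TotalPath V).length := Nat.succ_pos _
      rw [Finset.sum_eq_zero, sub_zero]
      · exact Submodule.subset_span ⟨_, hp, rfl⟩
      · intro c _
        rw [augmentation_mul_of_pos hR hp, zero_smul]
  simpa [f] using hf (Submodule.mem_top : x ∈ _)

variable (k) in
/-- The map from the monomial algebra to its coregular module given by the augmentation. -/
def toCoregular (hR : ∀ r ∈ R, r.length = 2) :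
    MonomialAlgebra k R →ₗ[MonomialAlgebra k R] CoregularModule k (MonomialAlgebra k R) :=
  LinearMap.toSpanSingleton _ _ (CoregularModule.of (augmentation k hR))

theorem toCoregular_apply_apply (hR : ∀ r ∈ R, r.length = 2) (x y : MonomialAlgebra k R) :
    toCoregular k hR x y = augmentation k hR (y * x) := rfl

theorem ker_toCoregular (hR : ∀ r ∈ R, r.length = 2) :
    LinearMap.ker (toCoregular k hR) = augmentationIdeal k R := by
  refine le_antisymm ?_ ?_
  · intro x hx
    have h := sub_sum_mem_augmentationIdeal hR x
    rwa [Finset.sum_eq_zero, sub_zero] at h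
    intro a _
    rw [← toCoregular_apply_apply, LinearMap.mem_ker.1 hx, CoregularModule.zero_apply, zero_smul]
  · rw [augmentationIdeal, Submodule.span_le]
    rintro _ ⟨p, hp, rfl⟩
    exact CoregularModule.ext fun y => augmentation_mul_of_pos hR hp y

/-- A form vanishing on all arrow ideals is determined by its values at the vertices, which
identifies Λ₀ with its own dual. The vacuous generator `1 - 1` gives the set the shape required by
`extSuccEquiv` with e = 1. -/
theorem range_toCoregular (hR : ∀ r ∈ R, r.length = 2) {κ : Type*} (b : κ ≃ TotalArrow V) :
    LinearMap.range (toCoregular k hR) =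
      coann k ({1 - 1} ∪ Set.range fun j => arrow k R (b j)) := by
  refine le_antisymm ?_ ?_
  · rintro _ ⟨x, rfl⟩ s (rfl | ⟨j, rfl⟩) y
    · rw [sub_self, zero_mul, map_zero]
    · rw [toCoregular_apply_apply, mul_assoc, augmentation_arrow_mul]
  · intro f hf
    refine ⟨∑ a, f (vertex k R a) • vertex k R a, CoregularModule.ext fun x => ?_⟩
    refine LinearMap.congr_fun (hom_ext
      (f := (toCoregular k hR (∑ a, f (vertex k R a) • vertex k R a)).form) (g := f.form)
        fun p => ?_) x
    rw [form_apply, form_apply, toCoregular_apply_apply]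
    obtain ⟨a, c, p⟩ := p
    cases p with
    | nil =>
      change augmentation k hR (vertex k R a * _) = f (vertex k R a)
      rw [Finset.mul_sum, Finset.sum_eq_single a, mul_smul_comm, vertex_mul_vertex, map_smul,
        augmentation_vertex, smul_eq_mul, mul_one]
      · intro c _ hc
        rw [mul_smul_comm, vertex_mul_vertex_of_ne hc.symm, smul_zero]
      · simp
    | @cons m _ p e =>
      rw [← arrow_mul_ofPath, mul_assoc, augmentation_arrow_mul]
      refine (hf _ (Or.inr ⟨b.symm ⟨m, c, e⟩, ?_⟩) _).symm
      simp only [Equiv.apply_symm_apply]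

/-- The degree zero part as a submodule of the coregular module. -/
def degreeZeroEquiv (hR : ∀ r ∈ R, r.length = 2) {κ : Type*} (b : κ ≃ TotalArrow V) :
    DegreeZero k R ≃ₗ[MonomialAlgebra k R]
      coann k ({1 - 1} ∪ Set.range fun j => arrow k R (b j)) :=
  (Submodule.quotEquivOfEq _ _ (ker_toCoregular hR).symm).trans
    ((toCoregular k hR).quotKerEquivRange.trans (LinearEquiv.ofEq _ _ (range_toCoregular hR b)))

/-- Dimension shifting for the degree zero part. -/
def extDegreeZeroEquiv (hR : ∀ r ∈ R, r.length = 2) {κ : Type} [Fintype κ]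
    (b : κ ≃ TotalArrow V) (M : Type (max u v w)) [AddCommGroup M]
    [Module (MonomialAlgebra k R) M] (n : ℕ) :
    ExtDegreeZero k R M (n + 2) ≃ₗ[k]
      ∀ j, Abelian.Ext (ModuleCat.of (MonomialAlgebra k R) M)
        (ModuleCat.of (MonomialAlgebra k R) (dualOf k (arrow k R (b j)))) (n + 1) :=
  (Abelian.Ext.linearEquivOfIso k (LinearEquiv.toModuleIso (degreeZeroEquiv hR b)) _
    (n + 2)).trans <|
  extSuccEquiv (one_mul 1) (fun _ => one_mul _) (fun j => arrowProj k hR (b j))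
    (fun j => arrowProj_arrow_mul hR (b j))
    (fun _ _ x hij => arrowProj_arrow_mul_of_ne hR (fun h => hij (b.injective h)) x) _ n

theorem finite_degreeZero (hR : ∀ r ∈ R, r.length = 2) :
    Module.Finite k (DegreeZero k R) := by
  refine Module.Finite.of_surjective
    ((augmentationIdeal k R).mkQ.restrictScalars k ∘ₗ (vertexSpan k R).subtype) fun y => ?_
  obtain ⟨x, rfl⟩ := (augmentationIdeal k R).mkQ_surjective y
  refine ⟨⟨∑ a, augmentation k hR (vertex k R a * x) • vertex k R a, Submodule.sum_mem _ fun a _ =>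
    Submodule.smul_mem _ _ (Submodule.subset_span ⟨a, rfl⟩)⟩, ?_⟩
  exact ((Submodule.Quotient.eq _).2 (sub_sum_mem_augmentationIdeal hR x)).symm

/-! ### Finiteness and rationality. -/

section

variable [∀ a b : V, Finite (a ⟶ b)] (M : Type (max u v w)) [AddCommGroup M]
  [Module (MonomialAlgebra k R) M] [Module.FinitePresentation (MonomialAlgebra k R) M]

theorem finite_ext_succ_dualOf_arrow (hR : ∀ r ∈ R, r.length = 2) (a : TotalArrow V) (n : ℕ) :
    Module.Finite k (Abelian.Ext (ModuleCat.of (MonomialAlgebra k R) M)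
      (ModuleCat.of (MonomialAlgebra k R) (dualOf k (arrow k R a))) (n + 1)) := by
  classical
  induction n generalizing a with
  | zero => exact finite_ext_one_dualOf_arrow hR a M
  | succ n ih =>
    exact Module.Finite.equiv
      (extDualOfArrowEquiv hR (Finite.equivFin (TotalArrow V)).symm a _ n).symm

theorem finite_extDegreeZero (hR : ∀ r ∈ R, r.length = 2) (n : ℕ) :
    Module.Finite k (ExtDegreeZero k R M n) := by
  have := finite_degreeZero (k := k) hR
  match n with
  -- Dimension shifting reaches only degrees at least two. In degrees 0 and 1 the finite dimension
  -- of Λ₀ and the finite presentation of M suffice.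
  | 0 =>
    have : Module.Finite (MonomialAlgebra k R) (ModuleCat.of (MonomialAlgebra k R) M) :=
      inferInstanceAs (Module.Finite (MonomialAlgebra k R) M)
    exact finite_ext_zero_of_finite.{max u v w, w} _ (ModuleCat.of _ (DegreeZero k R))
      (AddMonoidHom.id (DegreeZero k R))
      Function.injective_id (algebraMap_smul (MonomialAlgebra k R))
  | 1 =>
    exact finite_ext_one_of_finite.{max u v w, w} M (ModuleCat.of _ (DegreeZero k R))
      (AddMonoidHom.id (DegreeZero k R))
      Function.injective_id (algebraMap_smul (MonomialAlgebra k R))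
  | n + 2 =>
    have := fun a => finite_ext_succ_dualOf_arrow (k := k) M hR a n
    exact Module.Finite.equiv
      (extDegreeZeroEquiv hR (Finite.equivFin (TotalArrow V)).symm M n).symm

theorem isRational_poincareSeries (hR : ∀ r ∈ R, r.length = 2) :
    (poincareSeries k R M).IsRational := by
  classical
  let b := (Finite.equivFin (TotalArrow V)).symm
  have hfin := fun n a => finite_ext_succ_dualOf_arrow (k := k) M hR a n
  -- The transition matrix of the recursion: the entry is 1 exactly when b_j ends where b_i starts
  -- and b_i b_j = 0.
  let N : Matrix (Fin (Nat.card (TotalArrow V))) (Fin (Nat.card (TotalArrow V))) ℚ :=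
    fun i j => if (b j).2.1 = (b i).1 ∧ arrow k R (b i) * arrow k R (b j) = 0 then 1 else 0
  refine isRational_mk_of_matrix_recursion N (fun n i => (Module.finrank k
    (Abelian.Ext (ModuleCat.of (MonomialAlgebra k R) M)
      (ModuleCat.of (MonomialAlgebra k R) (dualOf k (arrow k R (b i)))) (n + 1)) : ℚ))
    (fun n => funext fun i => ?_) _ fun n => ?_
  · rw [(extDualOfArrowEquiv hR b (b i) _ n).finrank_eq, Module.finrank_pi_fintype, Nat.cast_sum]
    simp only [Matrix.mulVec, dotProduct, N, ite_mul, one_mul, zero_mul]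
    rw [← Finset.sum_filter]
    symm
    exact Finset.sum_subtype _ (fun j => by simp) _
  · rw [(extDegreeZeroEquiv hR b M n).finrank_eq, Module.finrank_pi_fintype, Nat.cast_sum]

end

end MonomialAlgebra

end

theorem corollary3p6 {k : Type w} [Field k] {V : Type u} [Quiver.{v} V] [DecidableEq V] [Fintype V]
    [∀ a b : V, Finite (a ⟶ b)]
    (R : Set (TotalPath V)) (hR : ∀ r ∈ R, r.length = 2)
    (M : Type (max u v w)) [AddCommGroup M] [Module k M] [Module (MonomialAlgebra k R) M]
    [IsScalarTower k (MonomialAlgebra k R) M]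
    (ℳ : ℤ → Submodule k M) [DirectSum.Decomposition ℳ]
    [SetLike.GradedSMul (MonomialAlgebra.grading k R) ℳ]
    [Module.FinitePresentation (MonomialAlgebra k R) M] :
    (∀ n : ℕ, Module.Finite k (MonomialAlgebra.ExtDegreeZero k R M n)) ∧
      (MonomialAlgebra.poincareSeries k R M).IsRational := by
  exact ⟨MonomialAlgebra.finite_extDegreeZero M hR,
    MonomialAlgebra.isRational_poincareSeries M hR⟩
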